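/- Let $X$ be a set, $H$ a complex Hilbert space (inner products are linear in the second variable), and $K:X\times X\to B(H)$ a positive definite kernel, i.e. $\sum_{i,j}\langle h_i,K(x_i,x_j)h_j\rangle\ge 0$ for all finite families $(x_i,h_i)$ in $X\times H$. Let $\mathcal H_{\tilde K}$ be the reproducing kernel Hilbert space of the scalar kernel $\tilde K((x,a),(y,b))=\langle a,K(x,y)b\rangle$ on $X\times H$, with kernel sections $\tilde K_{(x,a)}=\tilde K(\cdot,(x,a))$. Let $S$ be a measurable space. For each $s\in S$ let $\Phi_s:B(H)\to B(H)$ be a normal completely positive map with a Kraus family $(A_{s,r})_{r\in I(s)}$ in $B(H)$, i.e. $\Phi_s(T)=\sum_{r\in I(s)}A_{s,r}^*TA_{s,r}$ in the strong operator topology for every $T\in B(H)$. Let $R$ be the disjoint union, over all finite words $s_1\cdots s_n$ in $S$ (including the empty word, which contributes the empty string), of the sets $I(s_1)\times\cdots\times I(s_n)$. Let $M=\ell^2(R)\otimes\mathcal H_{\tilde K}$, write $e_\rho\cdot F=e_\rho\otimes F$, and let $r\rho$ be the index string obtained by writing $r$ in front of $\rho$. Assume that for each $s\in S$ the formula $$C_s\bigl(e_\rho\cdot\tilde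 K_{(x,a)}\bigr)=\sum_{r\in I(s)}e_{r\rho}\cdot\tilde K_{(x,A_{s,r}a)}\qquad(\rho\in R,\ x\in X,\ a\in H)$$ defines a bounded operator $C_s:M\to M$. For a word $w=s_1\cdots s_n$ put $C_w=C_{s_n}\cdots C_{s_1}$, and $C_\emptyset=I_M$. Let $\mu$ be a probability measure on $S$ and let $\Omega=S^{\mathbb N}$ carry the product $\sigma$-algebra and $\mathbb P=\mu^{\otimes\mathbb N}$. Let $z_n(\omega)=\omega_n$ be the coordinate maps (i.i.d. with law $\mu$), and $\xi_n(\omega)=z_1(\omega)\cdots z_n(\omega)$, so that $C_{\xi_n(\omega)}=C_{z_n(\omega)}\cdots C_{z_1(\omega)}$. Assume that $\omega\mapsto\|C_{\xi_n(\omega)}\|$ is measurable for every $n$, and that $\mathbb E[\log^+\|C_{z_1}\|]<\infty$, where $\log^+t=\max\{0,\log t\}$. Write $\log 0=-\infty$. Then $\mathbb E[\log^+\|C_{\xi_n}\|]<\infty$ for every $n$, so that $\mathbb E[\log\|C_{\xi_n}\|]\in[-\infty,\infty)$ is well defined, and there is a deterministic constant $\lambda\in[-\infty,\infty)$ such that $$\lim_{n\to\infty}\frac1n\log\|C_{\xi_n(\omega)}\|=\lambda\qquad\text{for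 }\mathbb P\text{-a.e. }\omega .$$ Moreover, $$\lambda=\inf_{n\ge1}\frac1n\,\mathbb E\bigl[\log\|C_{\xi_n}\|\bigr]=\lim_{n\to\infty}\frac1n\,\mathbb E\bigl[\log\|C_{\xi_n}\|\bigr].$$ -/

import Mathlib

open MeasureTheory Filter Topology
open scoped ComplexOrder CStarAlgebra

universe u v w t

/-- A `B(H)`-valued kernel `K` on `X` is positive definite if
`∑ i, ∑ j, ⟪h i, K (x i) (x j) (h j)⟫ ≥ 0` for every finite family `(x i, h i)` in `X × H`.
(The inner product is linear in the second variable; `0 ≤ z` in `ℂ` means that `z` is real and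
nonnegative.) -/
def IsPDKernel {X : Type u} {H : Type v} [NormedAddCommGroup H] [InnerProductSpace ℂ H]
    (K : X → X → H →L[ℂ] H) : Prop :=
  ∀ (m : ℕ) (x : Fin m → X) (h : Fin m → H),
    0 ≤ ∑ i, ∑ j, inner ℂ (h i) (K (x i) (x j) (h j))

/-- The scalar lift `K̃((x,a),(y,b)) = ⟪a, K(x,y) b⟫` of `K`, a kernel on `X × H`; a scalar is
regarded as the operator of multiplication by it on `ℂ`. -/
noncomputable def scalarLift {X : Type u} {H : Type v} [NormedAddCommGroup H]
    [InnerProductSpace ℂ H] (K : X → X → H →L[ℂ] H) : Matrix (X × H) (X × H) (ℂ →L[ℂ] ℂ) :=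
  Matrix.of fun p q => inner ℂ p.2 (K p.1 q.1 q.2) • ContinuousLinearMap.id ℂ ℂ

/-- Positive definite kernels are Hermitian. -/
theorem IsPDKernel.conj_symm {X : Type u} {H : Type v} [NormedAddCommGroup H]
    [InnerProductSpace ℂ H] {K : X → X → H →L[ℂ] H} (hK : IsPDKernel K) (x y : X) (a b : H) :
    star (inner ℂ a (K x y b) : ℂ) = inner ℂ b (K y x a) := by
  have key : ∀ a b : H,
      (inner ℂ a (K x y b) : ℂ).im + (inner ℂ b (K y x a) : ℂ).im = 0 := by
    intro a b
    have h1 := hK 1 ![x] ![a]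
    have h2 := hK 1 ![y] ![b]
    have h3 := hK 2 ![x, y] ![a, b]
    simp [Fin.sum_univ_two] at h1 h2 h3
    have e1 := (Complex.le_def.1 h1).2
    have e2 := (Complex.le_def.1 h2).2
    have e3 := (Complex.le_def.1 h3).2
    simp at e1 e2 e3
    linarith
  have k1 := key a b
  have k2 := key a (Complex.I • b)
  rw [map_smul, inner_smul_left, inner_smul_right] at k2
  simp only [Complex.conj_I, Complex.mul_im, Complex.neg_re, Complex.neg_im, Complex.I_re,
    Complex.I_im] at k2
  apply Complex.ext
  · rw [Complex.star_def, Complex.conj_re]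
    linarith
  · rw [Complex.star_def, Complex.conj_im]
    linarith

/-- The scalar lift of a positive definite kernel is positive semidefinite. -/
theorem IsPDKernel.posSemidef_scalarLift {X : Type u} {H : Type v} [NormedAddCommGroup H]
    [InnerProductSpace ℂ H] {K : X → X → H →L[ℂ] H} (hK : IsPDKernel K) :
    (scalarLift K).PosSemidef := by
  have tfae := (RKHS.posSemidef_tfae (K := scalarLift K)).out 0 2
  refine tfae.mpr ⟨?_, fun f => ?_⟩
  · ext p q
    have := hK.conj_symm q.1 p.1 q.2 p.2
    simp only [Matrix.conjTranspose_apply, scalarLift, Matrix.of_apply, star_smul]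
    rw [this]
    have hid : star (ContinuousLinearMap.id ℂ ℂ) = ContinuousLinearMap.id ℂ ℂ :=
      star_one (ℂ →L[ℂ] ℂ)
    rw [hid]
  · have h0 := hK (Fintype.card f.support) (fun i => ((Fintype.equivFin f.support).symm i).1.1)
      (fun i => f ((Fintype.equivFin f.support).symm i).1 •
        ((Fintype.equivFin f.support).symm i).1.2)
    rw [Equiv.sum_comp (Fintype.equivFin f.support).symm (fun p => ∑ j, inner ℂ (f p.1 • p.1.2)
      (K p.1.1 ((Fintype.equivFin f.support).symm j).1.1
        (f ((Fintype.equivFin f.support).symm j).1 •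
          ((Fintype.equivFin f.support).symm j).1.2)))] at h0
    have h1 : ∀ p : f.support, ∑ j, (inner ℂ (f p.1 • p.1.2)
      (K p.1.1 ((Fintype.equivFin f.support).symm j).1.1
        (f ((Fintype.equivFin f.support).symm j).1 •
          ((Fintype.equivFin f.support).symm j).1.2)) : ℂ) =
        ∑ q : f.support, inner ℂ (f p.1 • p.1.2) (K p.1.1 q.1.1 (f q.1 • q.1.2)) := fun p =>
      Equiv.sum_comp (Fintype.equivFin f.support).symm
        (fun q => inner ℂ (f p.1 • p.1.2) (K p.1.1 q.1.1 (f q.1 • q.1.2)))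
    simp only [h1] at h0
    have h2 := (Complex.le_def.1 h0).1
    have h3 : (∑ p : f.support, ∑ q : f.support,
        (inner ℂ (f p.1 • p.1.2) (K p.1.1 q.1.1 (f q.1 • q.1.2)) : ℂ)) =
        star (f.sum fun x w => f.sum fun x' w' => inner ℂ (scalarLift K x' x w) w') := by
      simp only [Finsupp.sum, star_sum]
      rw [Finset.sum_comm]
      rw [← Finset.sum_coe_sort f.support]
      refine Finset.sum_congr rfl fun q _ => ?_
      rw [← Finset.sum_coe_sort f.support]
      refine Finset.sum_congr rfl fun p _ => ?_
      simp [scalarLift]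
      ring
    rw [h3, Complex.star_def, Complex.conj_re] at h2
    exact h2

/-- The data of an iterated kernel system: a positive definite kernel `K : X × X → B(H)`, and a
family of completely positive maps `Φ s : B(H) → B(H)`, `s ∈ S`, with Kraus families
`(A s r)`, `r ∈ I s`, such that `Φ s T = ∑ r, (A s r)* T (A s r)` in the strong operator topology.
(A map with such a Kraus family is automatically normal.) -/
structure KernelSystem (X : Type u) (H : Type v) [NormedAddCommGroup H] [InnerProductSpace ℂ H]
    [CompleteSpace H] (S : Type w) (I : S → Type t) where
  K : X → X → H →L[ℂ] H
  isPDKernel : IsPDKernel K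
  Φ : S → (H →L[ℂ] H) →CP (H →L[ℂ] H)
  A : (s : S) → I s → H →L[ℂ] H
  kraus : ∀ (s : S) (T : H →L[ℂ] H) (h : H),
    HasSum (fun r : I s => (A s r).adjoint (T (A s r h))) (Φ s T h)

namespace KernelSystem

variable {X : Type u} {H : Type v} [NormedAddCommGroup H] [InnerProductSpace ℂ H]
  [CompleteSpace H] {S : Type w} {I : S → Type t}

instance fact_posSemidef (D : KernelSystem X H S I) : Fact (scalarLift D.K).PosSemidef :=
  ⟨D.isPDKernel.posSemidef_scalarLift⟩

/-- The reproducing kernel Hilbert space of the scalar lift `K̃`, a space of functions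
`X × H → ℂ`. -/
abbrev KernelSpace (D : KernelSystem X H S I) : Type (max u v) :=
  RKHS.OfKernel (scalarLift D.K)

/-- The kernel section `K̃_{(x,a)} = K̃(·, (x,a))`. -/
noncomputable def kernelSection (D : KernelSystem X H S I) (x : X) (a : H) : D.KernelSpace :=
  RKHS.kerFun D.KernelSpace (x, a) 1

theorem kernelSection_apply (D : KernelSystem X H S I) (x y : X) (a b : H) :
    D.kernelSection x a (y, b) = inner ℂ b (D.K y x a) := by
  rw [kernelSection, RKHS.kerFun_apply, RKHS.OfKernel.kernel_ofKernel]
  simp [scalarLift]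

theorem inner_kernelSection (D : KernelSystem X H S I) (x y : X) (a b : H) :
    inner ℂ (D.kernelSection x a) (D.kernelSection y b) = inner ℂ a (D.K x y b) := by
  conv_lhs => rw [kernelSection]
  rw [RKHS.kerFun_inner, kernelSection_apply]
  simp

/-- Finite index strings `ρ = (r₁, …, rₙ)`, where each letter `r ∈ I s` carries its label `s`:
the disjoint union over all words `s₁ ⋯ sₙ` of the products `I s₁ × ⋯ × I sₙ`. -/
abbrev IndexString (_D : KernelSystem X H S I) : Type (max w t) := List (Σ s : S, I s)

/-- The model space `M = ℓ²(R) ⊗ H_K̃`, as the Hilbert sum over the index strings `ρ ∈ R` of copies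
of `H_K̃`. -/
abbrev Model (D : KernelSystem X H S I) : Type (max u v w t) :=
  lp (fun _ : D.IndexString => D.KernelSpace) 2

open scoped Classical in
/-- The elementary tensor `e_ρ · F`. -/
noncomputable def tensor (D : KernelSystem X H S I) (ρ : D.IndexString) (F : D.KernelSpace) :
    D.Model :=
  lp.single 2 ρ F

/-- `C` is a bounded operator on `M` with
`C (e_ρ · K̃_{(x,a)}) = ∑ r ∈ I s, e_{rρ} · K̃_{(x, A_{s,r} a)}` for all `ρ`, `x`, `a`. -/
def IsCreationOp (D : KernelSystem X H S I) (s : S) (C : D.Model →L[ℂ] D.Model) : Prop :=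
  ∀ (ρ : D.IndexString) (x : X) (a : H),
    HasSum (fun r : I s => D.tensor (⟨s, r⟩ :: ρ) (D.kernelSection x (D.A s r a)))
      (C (D.tensor ρ (D.kernelSection x a)))

/-- The formula on elementary tensors determines the bounded operator. -/
theorem IsCreationOp.unique {D : KernelSystem X H S I} {s : S} {C C' : D.Model →L[ℂ] D.Model}
    (h : D.IsCreationOp s C) (h' : D.IsCreationOp s C') : C = C' := by
  classical
  have hs : ∀ ρ : D.IndexString,
      C ∘L (lp.singleContinuousLinearMap ℂ (fun _ : D.IndexString => D.KernelSpace) 2 ρ) =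
      C' ∘L (lp.singleContinuousLinearMap ℂ (fun _ : D.IndexString => D.KernelSpace) 2 ρ) := by
    intro ρ
    refine ContinuousLinearMap.ext_on (s := {x | ∃ (p : X × H) (c : ℂ),
      RKHS.kerFun D.KernelSpace p c = x}) ?_ ?_
    · exact Submodule.dense_iff_topologicalClosure_eq_top.2 (RKHS.kerFun_dense D.KernelSpace)
    · rintro _ ⟨⟨x, a⟩, c, rfl⟩
      have hc : RKHS.kerFun D.KernelSpace (x, a) c = c • D.kernelSection x a := by
        rw [kernelSection, ← map_smul]; simp
      have := (h ρ x a).unique (h' ρ x a)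
      rw [hc, map_smul, map_smul]
      exact congrArg (c • ·) this
  exact lp.ext_continuousLinearMap (by norm_num) hs

/-- The operator `C_s` on the model space: the unique bounded operator given by
the formula in `IsCreationOp` on elementary tensors, when that formula does define a bounded
operator (and `0` otherwise). -/
noncomputable def creationOp (D : KernelSystem X H S I) (s : S) : D.Model →L[ℂ] D.Model :=
  open scoped Classical in
  if h : ∃ C : D.Model →L[ℂ] D.Model, D.IsCreationOp s C then h.choose else 0

theorem isCreationOp_creationOp (D : KernelSystem X H S I) (s : S)
    (h : ∃ C : D.Model →L[ℂ] D.Model, D.IsCreationOp s C) :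
    D.IsCreationOp s (D.creationOp s) := by
  rw [creationOp, dif_pos h]
  exact h.choose_spec

/-- `C_w = C_{sₙ} ⋯ C_{s₁}` for a word `w = s₁ ⋯ sₙ`, and the identity for the empty word. -/
noncomputable def wordOp (D : KernelSystem X H S I) : List S → (D.Model →L[ℂ] D.Model)
  | [] => ContinuousLinearMap.id ℂ D.Model
  | s :: w => (D.wordOp w).comp (D.creationOp s)

/-- `log ‖C_w‖ ∈ [-∞, ∞)`, with `log 0 = -∞`. -/
noncomputable def logNorm (D : KernelSystem X H S I) (w : List S) : EReal :=
  ENNReal.log (ENNReal.ofReal ‖D.wordOp w‖)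

end KernelSystem

/-- The random word `ξₙ(ω) = z₁(ω) ⋯ zₙ(ω)`, where `z_{k+1}(ω) = ω k` are the coordinates of the
path `ω`. -/
def randomWord {S : Type w} (n : ℕ) (ω : ℕ → S) : List S := List.ofFn fun i : Fin n => ω i

/-- The expectation `E[Y] = E[Y⁺] - E[Y⁻]` of an extended real random variable; it is meaningful,
with a value in `[-∞, ∞)`, as soon as `E[Y⁺] < ∞`. -/
noncomputable def extExpectation {Ω : Type w} [MeasurableSpace Ω] (P : Measure Ω) (Y : Ω → EReal) :
    EReal :=
  ((∫⁻ ω, (Y ω).toENNReal ∂P : ENNReal) : EReal) - ((∫⁻ ω, (-Y ω).toENNReal ∂P : ENNReal) : EReal)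

open ProbabilityTheory

/-! The operators enter only through C_{uv} = C_v C_u: with θ the shift, the norms p_n(ω) =
‖C_{ξ_n(ω)}‖ satisfy p_{m+n} ≤ p_m · (p_n ∘ θ^m), and p_n depends on n coordinates only. The theorem
is thus the Furstenberg–Kesten theorem for such cocycles over a Bernoulli shift
(`furstenberg_kesten`). The constant is taken to be the infimum of the means E[log p_n]/n, and
Fekete's lemma (`tendsto_iInf_of_subadditive`) makes the means converge to it.

Upper bound (`ae_eventually_le_exp`): cut the path into blocks of a fixed length m. The block terms
are i.i.d., so the strong law of large numbers bounds the growth rate by E[log p_m]/m. Truncating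
log p_m from below keeps it integrable even when its mean is -∞.

Lower bound (`ae_eventually_exp_le`): it is vacuous for λ = -∞, so every log p_n with n ≥ 1 may be
taken integrable. If p_n < C exp(cn) infinitely often for some C, with positive probability and c <
λ, a zero-one law makes this almost sure. Cutting paths greedily into pieces of slow growth
(`le_exp_sum`) and integrating then gives λ ≤ c' for some c' < λ
(`le_of_forall_mul_le_integral_log`), a contradiction. -/

/-- The `n`-th iterate of the shift on one-sided paths. -/
def pathShift {S : Type w} (n : ℕ) (ω : ℕ → S) : ℕ → S := fun k => ω (k + n)

theorem pathShift_zero {S : Type w} (ω : ℕ → S) : pathShift 0 ω = ω := rfl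

theorem pathShift_pathShift {S : Type w} (m n : ℕ) (ω : ℕ → S) :
    pathShift m (pathShift n ω) = pathShift (m + n) ω := by
  funext k
  simp [pathShift, add_assoc]

/-- A function of a path that only depends on the first `n` coordinates. -/
def DependsOnFirst {S : Type w} {β : Type*} (n : ℕ) (f : (ℕ → S) → β) : Prop :=
  ∀ ω ω' : ℕ → S, (∀ i < n, ω i = ω' i) → f ω = f ω'

/-! ### The Bernoulli shift: zero-one law and block averages. -/

section Shift

variable {S : Type w} [MeasurableSpace S]

@[fun_prop]
theorem measurable_pathShift (n : ℕ) : Measurable (pathShift n : (ℕ → S) → ℕ → S) :=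
  measurable_pi_lambda _ fun _ => measurable_pi_apply _

theorem measurePreserving_pathShift (μ : Measure S) [IsProbabilityMeasure μ] (n : ℕ) :
    MeasurePreserving (pathShift n) (Measure.infinitePi fun _ : ℕ => μ)
      (Measure.infinitePi fun _ : ℕ => μ) :=
  ⟨measurable_pathShift n,
    Measure.map_infinitePi_infinitePi_of_inj (P := fun _ : ℕ => μ) (add_left_injective n)⟩

theorem iIndepFun_coordinates (μ : Measure S) [IsProbabilityMeasure μ] :
    iIndepFun (fun (i : ℕ) (ω : ℕ → S) => ω i) (Measure.infinitePi fun _ : ℕ => μ) :=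
  iIndepFun_infinitePi (X := fun _ x => x) fun _ => measurable_id

/-- A set that contains its preimage under the shift has probability `0` or `1`. -/
theorem measure_zero_or_one_of_shift_preimage_subset (μ : Measure S) [IsProbabilityMeasure μ]
    {E : Set (ℕ → S)} (hE : MeasurableSet E) (hsub : pathShift 1 ⁻¹' E ⊆ E) :
    Measure.infinitePi (fun _ : ℕ => μ) E = 0 ∨ Measure.infinitePi (fun _ : ℕ => μ) E = 1 := by
  set P := Measure.infinitePi fun _ : ℕ => μ
  -- The preimages of `E` decrease and all have the measure of `E`, so their intersection has it
  -- too; that intersection is a tail event, to which Kolmogorov's law applies.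
  have hanti : Antitone fun n => pathShift n ⁻¹' E := by
    refine antitone_nat_of_succ_le fun n ω hω => hsub ?_
    simpa [Set.mem_preimage, pathShift_pathShift, add_comm] using hω
  have hmeasure : P (⋂ n, pathShift n ⁻¹' E) = P E := by
    rw [hanti.measure_iInter (fun n => (measurable_pathShift n hE).nullMeasurableSet)
      ⟨0, measure_ne_top _ _⟩]
    simp only [(measurePreserving_pathShift μ _).measure_preimage hE.nullMeasurableSet, P]
    exact ciInf_const
  rw [← hmeasure]
  refine measure_zero_or_one_of_measurableSet_limsup_atTop
    (s := fun i : ℕ => MeasurableSpace.comap (fun ω : ℕ → S => ω i) inferInstance)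
    (fun n => (measurable_pi_apply n).comap_le) (iIndepFun_coordinates μ).iIndep ?_
  rw [limsup_eq_iInf_iSup_of_nat]
  refine MeasurableSpace.measurableSet_iInf.2 fun n => ?_
  -- Dropping the first `n` sets of a decreasing sequence leaves the intersection unchanged, and
  -- what remains involves only coordinates of index at least `n`.
  have heq : ⋂ k, pathShift k ⁻¹' E = ⋂ k, pathShift (k + n) ⁻¹' E :=
    (hanti.iInf_nat_add n).symm
  rw [heq]
  refine @MeasurableSet.iInter _ _ _ _ _ fun k => ?_
  have hm : Measurable[⨆ i ≥ n, MeasurableSpace.comap (fun ω : ℕ → S => ω i) inferInstance]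
      (pathShift (k + n) : (ℕ → S) → ℕ → S) := by
    refine @measurable_pi_lambda _ _ _ (_) _ _ fun j => ?_
    refine Measurable.of_comap_le ?_
    exact le_iSup₂_of_le (j + (k + n)) (by omega) le_rfl
  exact hm hE

/-- The strong law of large numbers along consecutive blocks of length `m`. -/
theorem tendsto_block_average (μ : Measure S) [IsProbabilityMeasure μ] {m : ℕ}
    {Y : (ℕ → S) → ℝ} (hY : Measurable Y) (hdep : DependsOnFirst m Y)
    (hint : Integrable Y (Measure.infinitePi fun _ : ℕ => μ)) :
    ∀ᵐ ω ∂(Measure.infinitePi fun _ : ℕ => μ),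
      Tendsto (fun k : ℕ => (∑ j ∈ Finset.range k, Y (pathShift (m * j) ω)) / k) atTop
        (𝓝 (∫ ω, Y ω ∂(Measure.infinitePi fun _ : ℕ => μ))) := by
  set P := Measure.infinitePi fun _ : ℕ => μ
  obtain ⟨s₀⟩ : Nonempty S := μ.nonempty_of_neZero
  have key := strong_law_ae_real (μ := P) (fun j ω => Y (pathShift (m * j) ω)) hint ?_ ?_
  · exact key
  · intro i j hij
    -- Rebuilds a path from its `k`-th block. The filler `s₀` is harmless because `Y` sees only `m`
    -- coordinates; so each block term factors through its own block, and disjoint blocks are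
    -- independent.
    let pad (k : ℕ) (v : Finset.Ico (m * k) (m * k + m) → S) : ℕ → S := fun l =>
      if h : l < m then v ⟨l + m * k, by rw [Finset.mem_Ico]; omega⟩ else s₀
    have hpad : ∀ k, Measurable (pad k) := fun k => by
      refine measurable_pi_lambda _ fun l => ?_
      by_cases h : l < m
      · simp only [pad, h, dif_pos]
        exact measurable_pi_apply _
      · simp only [pad, h, dif_neg, not_false_eq_true]
        exact measurable_const
    have hfac : ∀ k, (fun ω => Y (pathShift (m * k) ω)) =
        (fun v => Y (pad k v)) ∘ fun ω (i : Finset.Ico (m * k) (m * k + m)) => ω i := by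
      intro k
      funext ω
      refine hdep _ _ fun l hl => ?_
      simp [pad, hl, pathShift]
    have hdisj : Disjoint (Finset.Ico (m * i) (m * i + m)) (Finset.Ico (m * j) (m * j + m)) := by
      rw [Finset.disjoint_left]
      intro l hl hl'
      rw [Finset.mem_Ico] at hl hl'
      rcases lt_or_gt_of_ne hij with h | h
      · have := Nat.mul_le_mul_left m (Nat.succ_le_of_lt h)
        rw [Nat.mul_succ] at this
        omega
      · have := Nat.mul_le_mul_left m (Nat.succ_le_of_lt h)
        rw [Nat.mul_succ] at this
        omega
    have := (iIndepFun_coordinates μ).indepFun_finset _ _ hdisj fun i => measurable_pi_apply i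
    change IndepFun (fun ω => Y (pathShift (m * i) ω)) (fun ω => Y (pathShift (m * j) ω)) P
    rw [hfac i, hfac j]
    exact this.comp (hY.comp (hpad i)) (hY.comp (hpad j))
  · intro i
    refine ⟨(hY.comp (measurable_pathShift _)).aemeasurable, hY.aemeasurable, ?_⟩
    have h := Measure.map_map (μ := P) hY (measurable_pathShift (m * i))
    rw [(measurePreserving_pathShift μ (m * i)).map_eq] at h
    exact h.symm

/-! ### Submultiplicative cocycles and pathwise bounds. -/

/-- A submultiplicative cocycle of nonnegative functions over the shift, where the `n`-th function
depends on the first `n` coordinates. -/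
structure IsSubmulCocycle (p : ℕ → (ℕ → S) → ℝ) : Prop where
  nonneg : ∀ n ω, 0 ≤ p n ω
  zero_le_one : ∀ ω, p 0 ω ≤ 1
  add_le : ∀ m n ω, p (m + n) ω ≤ p m ω * p n (pathShift m ω)
  measurable : ∀ n, Measurable (p n)
  dependsOnFirst : ∀ n, DependsOnFirst n (p n)

namespace IsSubmulCocycle

variable {p : ℕ → (ℕ → S) → ℝ}

theorem le_exp_posLog {x : ℝ} (hx : 0 ≤ x) : x ≤ Real.exp (Real.posLog x) := by
  rcases hx.eq_or_lt with rfl | hx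
  · exact (Real.exp_pos _).le
  · calc x = Real.exp (Real.log x) := (Real.exp_log hx).symm
      _ ≤ _ := Real.exp_le_exp.2 (le_max_right _ _)

/-- Pathwise bounds are kept in exponential form, which stays meaningful where the cocycle vanishes.
-/
theorem add_le_exp (hp : IsSubmulCocycle p) {m n : ℕ} {ω : ℕ → S} {a b : ℝ}
    (ha : p m ω ≤ Real.exp a) (hb : p n (pathShift m ω) ≤ Real.exp b) :
    p (m + n) ω ≤ Real.exp (a + b) := by
  rw [Real.exp_add]
  exact (hp.add_le m n ω).trans (mul_le_mul ha hb (hp.nonneg _ _) (Real.exp_pos _).le)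

/-- The growth of the cocycle along a path is controlled by the visits to the set of paths along
which the growth is not smaller than `exp (c n)` at any of the first `N` times. -/
theorem le_exp_sum (hp : IsSubmulCocycle p) {c : ℝ} {N : ℕ} {G : (ℕ → S) → ℝ} {B : Set (ℕ → S)}
    (hG0 : ∀ ω, 0 ≤ G ω) (hG : ∀ ω, p 1 ω ≤ Real.exp (c + G ω))
    (hB : ∀ ω ∉ B, ∃ n, 1 ≤ n ∧ n ≤ N ∧ p n ω ≤ Real.exp (c * n)) (n : ℕ) (ω : ℕ → S) :
    p n ω ≤ Real.exp (c * n + ∑ k ∈ Finset.range n,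
      (B.indicator G (pathShift k ω) + if n ≤ k + N then G (pathShift k ω) else 0)) := by
  -- Greedy cutting: off `B`, jump over a good piece of length `m ≤ n` at no cost beyond `c * m`;
  -- otherwise take one step and pay `G`. A payment off `B` occurs only if the good piece overshoots
  -- the end, hence within the last `N` times; the second summand accounts for these.
  induction n using Nat.strong_induction_on generalizing ω with
  | _ n ih =>
  have hterm : ∀ k, 0 ≤ B.indicator G (pathShift k ω) + if n ≤ k + N then G (pathShift k ω) else 0 :=
    fun k => add_nonneg (Set.indicator_nonneg (fun _ _ => hG0 _) _)
      (by split_ifs; exacts [hG0 _, le_rfl])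
  -- joining a first piece of length `m` to the bound for the remaining piece
  have hjoin : ∀ m, 1 ≤ m → m ≤ n → ∀ a, p m ω ≤ Real.exp (c * m + a) →
      a ≤ (∑ k ∈ Finset.range m, (B.indicator G (pathShift k ω) +
        if n ≤ k + N then G (pathShift k ω) else 0)) →
      p n ω ≤ Real.exp (c * n + ∑ k ∈ Finset.range n,
        (B.indicator G (pathShift k ω) + if n ≤ k + N then G (pathShift k ω) else 0)) := by
    intro m hm hmn a ha hsum
    obtain ⟨l, rfl⟩ := Nat.exists_eq_add_of_le hmn
    refine (hp.add_le_exp ha (ih l (by omega) (pathShift m ω))).trans (Real.exp_le_exp.2 ?_)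
    rw [Finset.sum_range_add]
    have heq : ∀ k ∈ Finset.range l, (B.indicator G (pathShift k (pathShift m ω)) +
        if l ≤ k + N then G (pathShift k (pathShift m ω)) else 0) =
        B.indicator G (pathShift (m + k) ω) +
        if m + l ≤ m + k + N then G (pathShift (m + k) ω) else 0 := by
      intro k _
      rw [pathShift_pathShift, add_comm k m, add_assoc m k N]
      simp only [add_le_add_iff_left]
    rw [Finset.sum_congr rfl heq]
    push_cast
    linarith
  rcases Nat.eq_zero_or_pos n with rfl | hn
  · simpa using hp.zero_le_one ω
  by_cases hω : ω ∈ B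
  · refine hjoin 1 le_rfl hn (G ω) (by simpa using hG ω) ?_
    rw [Finset.sum_range_one, pathShift_zero, Set.indicator_of_mem hω]
    have : (0 : ℝ) ≤ if n ≤ 0 + N then G ω else 0 := by split_ifs; exacts [hG0 _, le_rfl]
    linarith
  · obtain ⟨m, hm1, hmN, hm⟩ := hB ω hω
    by_cases hmn : m ≤ n
    · exact hjoin m hm1 hmn 0 (by simpa using hm) (Finset.sum_nonneg fun k _ => hterm k)
    · refine hjoin 1 le_rfl hn (G ω) (by simpa using hG ω) ?_
      rw [Finset.sum_range_one, pathShift_zero, Set.indicator_of_notMem hω,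
        if_pos (by omega), zero_add]

end IsSubmulCocycle

end Shift

/-! ### Expectations of logarithms with value in [-∞, ∞), and truncation. -/

section LogExpectation

/-- Truncating the logarithm at `-R` caps its negative part at `R`. For `x = 0` the negative part is
`⊤` and both sides equal `-R`. -/
theorem log_max_exp_eq {x R : ℝ} (hx : 0 ≤ x) (hR : 0 ≤ R) :
    Real.log (max x (Real.exp (-R))) = Real.posLog x -
      (min (-ENNReal.log (ENNReal.ofReal x)).toENNReal (ENNReal.ofReal R)).toReal := by
  rcases hx.eq_or_lt with rfl | hx
  · simp [(Real.exp_pos _).le, hR]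
  · rw [ENNReal.log_ofReal_of_pos hx, ← EReal.coe_neg, EReal.real_coe_toENNReal,
      ← ENNReal.ofReal_min, ENNReal.toReal_ofReal']
    have hlog : Real.log (max x (Real.exp (-R))) = max (Real.log x) (-R) := by
      rw [Real.strictMonoOn_log.monotoneOn.map_max hx (Real.exp_pos _), Real.log_exp]
    rw [hlog, Real.posLog_apply]
    grind

variable {Ω : Type w} [MeasurableSpace Ω] {P : Measure Ω} {f : Ω → ℝ}

theorem lintegral_log_toENNReal (hf : ∀ ω, 0 ≤ f ω)
    (hint : Integrable (fun ω => Real.posLog (f ω)) P) :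
    ∫⁻ ω, (ENNReal.log (ENNReal.ofReal (f ω))).toENNReal ∂P =
      ENNReal.ofReal (∫ ω, Real.posLog (f ω) ∂P) := by
  rw [ofReal_integral_eq_lintegral_ofReal hint (.of_forall fun _ => Real.posLog_nonneg)]
  refine lintegral_congr fun ω => ?_
  rcases (hf ω).eq_or_lt with h | h
  · simp [← h]
  · rw [ENNReal.log_ofReal_of_pos h, EReal.real_coe_toENNReal, Real.posLog_apply]
    rcases le_total (Real.log (f ω)) 0 with h' | h'
    · rw [max_eq_left h', ENNReal.ofReal_of_nonpos h', ENNReal.ofReal_zero]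
    · rw [max_eq_right h']

theorem extExpectation_log_eq (hf : ∀ ω, 0 ≤ f ω)
    (hint : Integrable (fun ω => Real.posLog (f ω)) P) :
    extExpectation P (fun ω => ENNReal.log (ENNReal.ofReal (f ω))) =
      ((∫ ω, Real.posLog (f ω) ∂P : ℝ) : EReal) -
        ((∫⁻ ω, (-ENNReal.log (ENNReal.ofReal (f ω))).toENNReal ∂P : ENNReal) : EReal) := by
  rw [extExpectation, lintegral_log_toENNReal hf hint, EReal.coe_ennreal_ofReal,
    max_eq_left (integral_nonneg fun _ => Real.posLog_nonneg)]

theorem measurable_neg_log_toENNReal (hm : Measurable f) :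
    Measurable fun ω => (-ENNReal.log (ENNReal.ofReal (f ω))).toENNReal :=
  ((ENNReal.measurable_log.comp hm.ennreal_ofReal).neg).ereal_toENNReal

theorem extExpectation_log_lt_top (hf : ∀ ω, 0 ≤ f ω)
    (hint : Integrable (fun ω => Real.posLog (f ω)) P) :
    extExpectation P (fun ω => ENNReal.log (ENNReal.ofReal (f ω))) < ⊤ := by
  rw [extExpectation_log_eq hf hint]
  generalize (∫⁻ ω, (-ENNReal.log (ENNReal.ofReal (f ω))).toENNReal ∂P) = a
  induction a with
  | top => simp
  | coe a =>
    rw [EReal.coe_nnreal_eq_coe_real, ← EReal.coe_sub]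
    exact EReal.coe_lt_top _

theorem extExpectation_log_ne_bot_iff (hf : ∀ ω, 0 ≤ f ω)
    (hint : Integrable (fun ω => Real.posLog (f ω)) P) :
    extExpectation P (fun ω => ENNReal.log (ENNReal.ofReal (f ω))) ≠ ⊥ ↔
      ∫⁻ ω, (-ENNReal.log (ENNReal.ofReal (f ω))).toENNReal ∂P ≠ ⊤ := by
  rw [extExpectation_log_eq hf hint]
  generalize (∫⁻ ω, (-ENNReal.log (ENNReal.ofReal (f ω))).toENNReal ∂P) = a
  induction a with
  | top => simp
  | coe a =>
    rw [EReal.coe_nnreal_eq_coe_real, ← EReal.coe_sub]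
    exact iff_of_true (EReal.coe_ne_bot _) ENNReal.coe_ne_top

/-- If the expectation of `log f` is not `-∞`, then it is the integral of `log f`. -/
theorem extExpectation_log_of_ne_bot (hf : ∀ ω, 0 ≤ f ω) (hm : Measurable f)
    (hint : Integrable (fun ω => Real.posLog (f ω)) P)
    (hne : extExpectation P (fun ω => ENNReal.log (ENNReal.ofReal (f ω))) ≠ ⊥) :
    (∀ᵐ ω ∂P, 0 < f ω) ∧ Integrable (fun ω => Real.log (f ω)) P ∧
      extExpectation P (fun ω => ENNReal.log (ENNReal.ofReal (f ω))) =
        ((∫ ω, Real.log (f ω) ∂P : ℝ) : EReal) := by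
  have hfin := (extExpectation_log_ne_bot_iff hf hint).1 hne
  have hmν := measurable_neg_log_toENNReal hm
  have hpos : ∀ᵐ ω ∂P, 0 < f ω := by
    filter_upwards [ae_lt_top hmν hfin] with ω hω
    refine (hf ω).lt_of_ne fun h => ?_
    simp [← h] at hω
  have hint' := integrable_toReal_of_lintegral_ne_top hmν.aemeasurable hfin
  have heq : ∀ᵐ ω ∂P, Real.posLog (f ω) -
      (-ENNReal.log (ENNReal.ofReal (f ω))).toENNReal.toReal = Real.log (f ω) := by
    filter_upwards [hpos] with ω hω
    rw [ENNReal.log_ofReal_of_pos hω, ← EReal.coe_neg, EReal.real_coe_toENNReal,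
      ENNReal.toReal_ofReal', Real.posLog_apply]
    grind
  refine ⟨hpos, (hint.sub hint').congr heq, ?_⟩
  rw [extExpectation_log_eq hf hint, ← integral_congr_ae heq, integral_sub hint hint',
    integral_toReal hmν.aemeasurable (ae_lt_top hmν hfin), EReal.coe_sub]
  congr 1
  rw [← EReal.toReal_coe_ennreal]
  exact (EReal.coe_toReal (EReal.coe_ennreal_eq_top_iff.not.2 hfin) (EReal.coe_ennreal_ne_bot _)).symm

/-- The hypothesis says `-log f ≤ h` almost everywhere, so the negative part of `log f` has finite
integral. -/
theorem extExpectation_log_ne_bot_of_exp_le (hf : ∀ ω, 0 ≤ f ω)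
    (hint : Integrable (fun ω => Real.posLog (f ω)) P) {h : Ω → ℝ} (hh : Integrable h P)
    (hle : ∀ᵐ ω ∂P, Real.exp (-h ω) ≤ f ω) :
    extExpectation P (fun ω => ENNReal.log (ENNReal.ofReal (f ω))) ≠ ⊥ := by
  rw [extExpectation_log_ne_bot_iff hf hint]
  refine ne_top_of_le_ne_top (hh.lintegral_lt_top.ne) (lintegral_mono_ae ?_)
  filter_upwards [hle] with ω hω
  have hpos := (Real.exp_pos _).trans_le hω
  rw [ENNReal.log_ofReal_of_pos hpos, ← EReal.coe_neg, EReal.real_coe_toENNReal]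
  refine ENNReal.ofReal_le_ofReal ?_
  have := (Real.le_log_iff_exp_le hpos).2 hω
  linarith

theorem integrable_log_max_exp [IsFiniteMeasure P] (hf : ∀ ω, 0 ≤ f ω) (hm : Measurable f)
    (hint : Integrable (fun ω => Real.posLog (f ω)) P) {R : ℝ} (hR : 0 ≤ R) :
    Integrable (fun ω => Real.log (max (f ω) (Real.exp (-R)))) P := by
  refine (hint.add (integrable_const R)).mono'
    (hm.max measurable_const).log.aestronglyMeasurable (.of_forall fun ω => ?_)
  have h1 := log_max_exp_eq (hf ω) hR
  have h2 : (min (-ENNReal.log (ENNReal.ofReal (f ω))).toENNReal (ENNReal.ofReal R)).toReal ≤ R :=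
    ENNReal.toReal_le_of_le_ofReal hR (min_le_right _ _)
  have h3 : 0 ≤ (min (-ENNReal.log (ENNReal.ofReal (f ω))).toENNReal (ENNReal.ofReal R)).toReal :=
    ENNReal.toReal_nonneg
  have h4 : 0 ≤ Real.posLog (f ω) := Real.posLog_nonneg
  rw [Real.norm_eq_abs, h1, abs_le]
  constructor <;> simp only [Pi.add_apply] <;> linarith

/-- The expectation of `log f` is approximated by the expectations of truncations. -/
theorem exists_integral_log_max_exp_lt [IsFiniteMeasure P] (hf : ∀ ω, 0 ≤ f ω) (hm : Measurable f)
    (hint : Integrable (fun ω => Real.posLog (f ω)) P) {c : ℝ}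
    (hc : extExpectation P (fun ω => ENNReal.log (ENNReal.ofReal (f ω))) < c) :
    ∃ R : ℝ, 0 ≤ R ∧ ∫ ω, Real.log (max (f ω) (Real.exp (-R))) ∂P < c := by
  have hmν := measurable_neg_log_toENNReal hm
  rw [extExpectation_log_eq hf hint] at hc
  -- Monotone convergence for the capped negative parts, valid also when the limit is infinite.
  have hlim : Tendsto (fun N : ℕ => ∫⁻ ω, min (-ENNReal.log (ENNReal.ofReal (f ω))).toENNReal
      (ENNReal.ofReal N) ∂P) atTop
      (𝓝 (∫⁻ ω, (-ENNReal.log (ENNReal.ofReal (f ω))).toENNReal ∂P)) := by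
    refine lintegral_tendsto_of_tendsto_of_monotone
      (fun N => (hmν.min measurable_const).aemeasurable) (.of_forall fun ω => ?_)
      (.of_forall fun ω => ?_)
    · intro N M hNM
      exact min_le_min_left _ (ENNReal.ofReal_le_ofReal (by exact_mod_cast hNM))
    · have : Tendsto (fun N : ℕ => ENNReal.ofReal (N : ℝ)) atTop (𝓝 ⊤) := by
        simpa using ENNReal.tendsto_nat_nhds_top
      simpa using (tendsto_const_nhds (x := (-ENNReal.log (ENNReal.ofReal (f ω))).toENNReal)).min this
  have hint_min : ∀ N : ℕ, ∫ ω, Real.log (max (f ω) (Real.exp (-(N : ℝ)))) ∂P =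
      ∫ ω, Real.posLog (f ω) ∂P - (∫⁻ ω, min (-ENNReal.log (ENNReal.ofReal (f ω))).toENNReal
      (ENNReal.ofReal N) ∂P).toReal ∧ (∫⁻ ω, min (-ENNReal.log (ENNReal.ofReal (f ω))).toENNReal
      (ENNReal.ofReal N) ∂P) ≠ ⊤ := by
    intro N
    have hfin : (∫⁻ ω, min (-ENNReal.log (ENNReal.ofReal (f ω))).toENNReal
        (ENNReal.ofReal N) ∂P) ≠ ⊤ := by
      refine ne_top_of_le_ne_top ?_ (lintegral_mono fun ω => min_le_right _ _)
      rw [lintegral_const]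
      exact ENNReal.mul_ne_top ENNReal.ofReal_ne_top (measure_ne_top _ _)
    have hm' := hmν.min (measurable_const (a := ENNReal.ofReal N))
    refine ⟨?_, hfin⟩
    rw [← integral_toReal hm'.aemeasurable (ae_lt_top hm' hfin), ← integral_sub hint
      (integrable_toReal_of_lintegral_ne_top hm'.aemeasurable hfin)]
    exact integral_congr_ae (.of_forall fun ω => log_max_exp_eq (hf ω) N.cast_nonneg)
  set a := ∫ ω, Real.posLog (f ω) ∂P
  set b := ∫⁻ ω, (-ENNReal.log (ENNReal.ofReal (f ω))).toENNReal ∂P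
  -- `ENNReal.ofReal` loses the sign of `a - c`. If it is negative, the positive part alone already
  -- has mean below `c`, and `R = 0` serves.
  have hab : (0 ≤ a - c ∧ ENNReal.ofReal (a - c) < b) ∨ a - c < 0 := by
    rcases lt_or_ge (a - c) 0 with h | h
    · exact .inr h
    refine .inl ⟨h, ?_⟩
    by_cases hb : b = ⊤
    · rw [hb]; exact ENNReal.ofReal_lt_top
    · rw [ENNReal.ofReal_lt_iff_lt_toReal h hb]
      rw [← EReal.coe_toReal (x := (b : EReal)) (by simpa using hb) (by simp), ← EReal.coe_sub,
        EReal.coe_lt_coe_iff, EReal.toReal_coe_ennreal] at hc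
      linarith
  rcases hab with ⟨h0, hab⟩ | hab
  · obtain ⟨N, hN⟩ := (hlim.eventually_const_lt hab).exists
    refine ⟨N, N.cast_nonneg, ?_⟩
    rw [(hint_min N).1]
    have := (ENNReal.ofReal_lt_iff_lt_toReal h0 (hint_min N).2).1 hN
    linarith
  · refine ⟨(0 : ℕ), Nat.cast_nonneg _, ?_⟩
    rw [(hint_min 0).1]
    have : 0 ≤ (∫⁻ ω, min (-ENNReal.log (ENNReal.ofReal (f ω))).toENNReal
      (ENNReal.ofReal (0 : ℕ)) ∂P).toReal := ENNReal.toReal_nonneg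
    linarith

end LogExpectation

/-! ### Almost sure upper and lower growth rates. -/

namespace IsSubmulCocycle

variable {S : Type w} [MeasurableSpace S] {p : ℕ → (ℕ → S) → ℝ}

theorem le_exp_sum_posLog (hp : IsSubmulCocycle p) (n : ℕ) (ω : ℕ → S) :
    p n ω ≤ Real.exp (∑ k ∈ Finset.range n, Real.posLog (p 1 (pathShift k ω))) := by
  induction n with
  | zero => simpa using hp.zero_le_one ω
  | succ n ih =>
    rw [Finset.sum_range_succ]
    exact hp.add_le_exp ih (le_exp_posLog (hp.nonneg _ _))

theorem posLog_le_sum (hp : IsSubmulCocycle p) (n : ℕ) (ω : ℕ → S) :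
    Real.posLog (p n ω) ≤ ∑ k ∈ Finset.range n, Real.posLog (p 1 (pathShift k ω)) := by
  refine max_le (Finset.sum_nonneg fun _ _ => Real.posLog_nonneg) ?_
  rcases (hp.nonneg n ω).eq_or_lt with h | h
  · rw [← h, Real.log_zero]
    exact Finset.sum_nonneg fun _ _ => Real.posLog_nonneg
  · exact (Real.log_le_iff_le_exp h).2 (hp.le_exp_sum_posLog n ω)

theorem measurable_posLog (hp : IsSubmulCocycle p) (n : ℕ) :
    Measurable fun ω => Real.posLog (p n ω) :=
  Real.continuous_posLog.measurable.comp (hp.measurable n)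

variable (μ : Measure S) [IsProbabilityMeasure μ]

local notation "𝔓" => Measure.infinitePi (fun _ : ℕ => μ)

theorem integrable_comp_pathShift {f : (ℕ → S) → ℝ} (hf : Integrable f 𝔓) (k : ℕ) :
    Integrable (fun ω => f (pathShift k ω)) 𝔓 :=
  (measurePreserving_pathShift μ k).integrable_comp_of_integrable hf

theorem integral_comp_pathShift {f : (ℕ → S) → ℝ} (hf : Measurable f) (k : ℕ) :
    ∫ ω, f (pathShift k ω) ∂𝔓 = ∫ ω, f ω ∂𝔓 := by
  conv_rhs => rw [← (measurePreserving_pathShift μ k).map_eq]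
  exact (integral_map (measurable_pathShift k).aemeasurable hf.aestronglyMeasurable).symm

theorem integrable_posLog (hp : IsSubmulCocycle p)
    (hint : Integrable (fun ω => Real.posLog (p 1 ω)) 𝔓) (n : ℕ) :
    Integrable (fun ω => Real.posLog (p n ω)) 𝔓 := by
  refine (integrable_finsetSum (Finset.range n) fun k _ =>
    integrable_comp_pathShift μ hint k).mono' (hp.measurable_posLog n).aestronglyMeasurable
    (.of_forall fun ω => ?_)
  rw [Real.norm_of_nonneg Real.posLog_nonneg]
  exact hp.posLog_le_sum n ω

/-- Almost surely, the cocycle eventually grows at most at the rate `c`, if one of its truncated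
logarithmic means is smaller than `c`. -/
theorem ae_eventually_le_exp (hp : IsSubmulCocycle p)
    (hint : Integrable (fun ω => Real.posLog (p 1 ω)) 𝔓) {m : ℕ} (hm : 1 ≤ m) {R c : ℝ}
    (hR : 0 ≤ R) (hc : ∫ ω, Real.log (max (p m ω) (Real.exp (-R))) ∂𝔓 < c * m) :
    ∀ᵐ ω ∂𝔓, ∀ᶠ n : ℕ in atTop, p n ω ≤ Real.exp (c * n) := by
  set Y : (ℕ → S) → ℝ := fun ω => Real.log (max (p m ω) (Real.exp (-R))) with hYdef
  -- `Y` bounds a full block, `Z` an incomplete block of any length below `m`.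
  set Z : (ℕ → S) → ℝ := fun ω => ∑ i ∈ Finset.range m, Real.posLog (p 1 (pathShift i ω)) with hZ
  have hZm : Measurable Z :=
    Finset.measurable_fun_sum _ fun i _ => (hp.measurable_posLog 1).comp (measurable_pathShift i)
  have hYdep : DependsOnFirst m Y := fun ω ω' h => by
    simp only [hYdef, hp.dependsOnFirst m ω ω' h]
  have hZdep : DependsOnFirst m Z := fun ω ω' h => by
    refine Finset.sum_congr rfl fun i hi => ?_
    rw [hp.dependsOnFirst 1 (pathShift i ω) (pathShift i ω') fun j hj => ?_]
    exact h _ (by have := Finset.mem_range.1 hi; omega)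
  have hYle : ∀ ω, p m ω ≤ Real.exp (Y ω) := fun ω => by
    rw [hYdef, Real.exp_log ((Real.exp_pos _).trans_le (le_max_right _ _))]
    exact le_max_left _ _
  have hYiter : ∀ (k : ℕ) (ω : ℕ → S),
      p (m * k) ω ≤ Real.exp (∑ j ∈ Finset.range k, Y (pathShift (m * j) ω)) := by
    intro k ω
    induction k with
    | zero => simpa using hp.zero_le_one ω
    | succ k ih =>
      rw [Finset.sum_range_succ, Nat.mul_succ]
      exact hp.add_le_exp ih (hYle _)
  have hrem : ∀ r < m, ∀ ω, p r ω ≤ Real.exp (Z ω) := fun r hr ω =>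
    (hp.le_exp_sum_posLog r ω).trans (Real.exp_le_exp.2
      (Finset.sum_le_sum_of_subset_of_nonneg (Finset.range_mono hr.le)
        fun _ _ _ => Real.posLog_nonneg))
  have hYm : Measurable Y := ((hp.measurable m).max measurable_const).log
  obtain ⟨c', hc1, hc2⟩ := exists_between hc
  filter_upwards [tendsto_block_average μ hYm hYdep
      (integrable_log_max_exp (hp.nonneg m) (hp.measurable m) (hp.integrable_posLog μ hint m) hR),
    tendsto_block_average μ hZm hZdep
      (integrable_finsetSum _ fun i _ => integrable_comp_pathShift μ hint i)] with ω h1 h2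
  set A : ℕ → ℝ := fun k => ∑ j ∈ Finset.range k, Y (pathShift (m * j) ω) with hA
  set T : ℕ → ℝ := fun k => ∑ j ∈ Finset.range k, Z (pathShift (m * j) ω) with hT
  -- The averages of the `Z`-terms converge, so a single term is `o(k)`: it is the difference of two
  -- consecutive partial sums.
  have h3 : Tendsto (fun k : ℕ => Z (pathShift (m * k) ω) / k) atTop (𝓝 0) := by
    have h4 : Tendsto (fun k : ℕ => T (k + 1) / ((k + 1 : ℕ) : ℝ) * (((k : ℝ) + 1) / k) - T k / k)
        atTop (𝓝 ((∫ ω, Z ω ∂𝔓) * 1 - ∫ ω, Z ω ∂𝔓)) := by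
      refine (((tendsto_add_atTop_iff_nat 1).2 h2).mul ?_).sub h2
      have : Tendsto (fun k : ℕ => 1 + 1 / (k : ℝ)) atTop (𝓝 (1 + 0)) :=
        tendsto_const_nhds.add tendsto_one_div_atTop_nhds_zero_nat
      rw [add_zero] at this
      refine this.congr' ?_
      filter_upwards [eventually_gt_atTop 0] with k hk
      have : (k : ℝ) ≠ 0 := by positivity
      field_simp
    rw [mul_one, sub_self] at h4
    refine h4.congr' ?_
    filter_upwards [eventually_gt_atTop 0] with k hk
    have hk' : (k : ℝ) ≠ 0 := by positivity
    have hk1 : (k : ℝ) + 1 ≠ 0 := by positivity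
    have : T (k + 1) = T k + Z (pathShift (m * k) ω) := Finset.sum_range_succ _ _
    rw [this]
    push_cast
    field_simp
    ring
  have h5 : ∀ᶠ k : ℕ in atTop, ∀ r < m, p (m * k + r) ω ≤ Real.exp (c * ((m * k + r : ℕ) : ℝ)) := by
    have h6 := (h1.add h3).eventually_lt_const ((add_zero _).trans_lt hc1)
    -- From here on the gap `k * (c * m - c')` absorbs the error `c * r ≥ -|c| * m` made in passing
    -- from time `m * k` to `m * k + r`.
    have h7 : ∀ᶠ k : ℕ in atTop, |c| * m / (c * m - c') ≤ k :=
      tendsto_natCast_atTop_atTop.eventually_ge_atTop _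
    filter_upwards [h6, h7, eventually_gt_atTop 0] with k h6 h7 hk r hr
    have hk' : (0 : ℝ) < k := by exact_mod_cast hk
    refine (hp.add_le_exp (hYiter k ω) (hrem r hr _)).trans (Real.exp_le_exp.2 ?_)
    rw [← add_div, div_lt_iff₀ hk'] at h6
    rw [div_le_iff₀ (by linarith)] at h7
    have h8 : -(|c| * m) ≤ c * r := by
      have hr' : (r : ℝ) ≤ m := by exact_mod_cast hr.le
      have := mul_le_mul_of_nonneg_left hr' (abs_nonneg c)
      have := mul_le_mul_of_nonneg_right (neg_abs_le c) (Nat.cast_nonneg (α := ℝ) r)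
      linarith
    push_cast
    nlinarith
  have hdiv : Tendsto (fun n : ℕ => n / m) atTop atTop := Nat.tendsto_div_const_atTop (by omega)
  filter_upwards [hdiv.eventually h5] with n hn
  have := hn (n % m) (Nat.mod_lt _ hm)
  rwa [Nat.div_add_mod] at this

/-- If the cocycle almost surely falls below `exp (c n)` at some time `n ≥ 1`, then the
logarithmic means are bounded by `c` in the long run. -/
theorem le_of_forall_mul_le_integral_log (hp : IsSubmulCocycle p)
    (hint : Integrable (fun ω => Real.posLog (p 1 ω)) 𝔓)
    (hpos : ∀ n, 1 ≤ n → ∀ᵐ ω ∂𝔓, 0 < p n ω)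
    (hlog : ∀ n, 1 ≤ n → Integrable (fun ω => Real.log (p n ω)) 𝔓) {l c : ℝ}
    (hl : ∀ n : ℕ, 1 ≤ n → l * n ≤ ∫ ω, Real.log (p n ω) ∂𝔓)
    (hc : ∀ᵐ ω ∂𝔓, ∃ n : ℕ, 1 ≤ n ∧ p n ω ≤ Real.exp (c * n)) : l ≤ c := by
  -- Adding `|c|` makes `c + G` at least `posLog (p 1 ω)`, so that `G` is a nonnegative cost of a
  -- single step above the rate `c`.
  set G : (ℕ → S) → ℝ := fun ω => Real.posLog (p 1 ω) + |c| with hG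
  have hG0 : ∀ ω, 0 ≤ G ω := fun ω => add_nonneg Real.posLog_nonneg (abs_nonneg _)
  have hGle : ∀ ω, p 1 ω ≤ Real.exp (c + G ω) := fun ω =>
    (le_exp_posLog (hp.nonneg 1 ω)).trans (Real.exp_le_exp.2 (by
      have := neg_abs_le c
      simp only [hG]
      linarith))
  have hGm : Measurable G := (hp.measurable_posLog 1).add_const _
  have hGi : Integrable G 𝔓 := hint.add (integrable_const _)
  set B : ℕ → Set (ℕ → S) := fun N => {ω | ∀ n : ℕ, 1 ≤ n → n ≤ N → Real.exp (c * n) < p n ω}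
  have hBm : ∀ N, MeasurableSet (B N) := fun N => by
    simp only [B, Set.ofPred_forall]
    exact .iInter fun n => .iInter fun _ => .iInter fun _ =>
      measurableSet_lt measurable_const (hp.measurable n)
  have hBind : ∀ N, Integrable ((B N).indicator G) 𝔓 := fun N => hGi.indicator (hBm N)
  -- Integrate the greedy bound. The payments near the end cost at most `N * ∫ G` in total, which is
  -- negligible against `n`; only the visits to `B N` survive.
  have hbound : ∀ N : ℕ, l - c ≤ ∫ ω, (B N).indicator G ω ∂𝔓 := by
    intro N
    have hn : ∀ n : ℕ, 1 ≤ n →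
        l * n ≤ c * n + n * (∫ ω, (B N).indicator G ω ∂𝔓) + N * ∫ ω, G ω ∂𝔓 := by
      intro n hn
      have hterm : ∀ k ∈ Finset.range n, Integrable (fun ω => (B N).indicator G (pathShift k ω) +
          if n ≤ k + N then G (pathShift k ω) else 0) 𝔓 := fun k _ => by
        refine (integrable_comp_pathShift μ (hBind N) k).add ?_
        split_ifs
        exacts [integrable_comp_pathShift μ hGi k, integrable_zero _ _ _]
      have hle : ∫ ω, Real.log (p n ω) ∂𝔓 ≤ ∫ ω, (c * n + ∑ k ∈ Finset.range n,
          ((B N).indicator G (pathShift k ω) + if n ≤ k + N then G (pathShift k ω) else 0)) ∂𝔓 := by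
        refine integral_mono_ae (hlog n hn)
          ((integrable_const _).add (integrable_finsetSum _ hterm)) ?_
        filter_upwards [hpos n hn] with ω hω
        rw [Real.log_le_iff_le_exp hω]
        refine hp.le_exp_sum hG0 hGle (fun ω hω => ?_) n ω
        simpa [B] using hω
      rw [integral_add (integrable_const _) (integrable_finsetSum _ hterm),
        integral_finsetSum _ hterm] at hle
      have hsum : ∀ k ∈ Finset.range n, (∫ ω, ((B N).indicator G (pathShift k ω) +
          if n ≤ k + N then G (pathShift k ω) else 0) ∂𝔓) =
          (∫ ω, (B N).indicator G ω ∂𝔓) + if n ≤ k + N then ∫ ω, G ω ∂𝔓 else 0 := fun k _ => by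
        rw [integral_add (integrable_comp_pathShift μ (hBind N) k),
          integral_comp_pathShift μ (hGm.indicator (hBm N))]
        · split_ifs
          · rw [integral_comp_pathShift μ hGm]
          · rw [integral_zero]
        · split_ifs
          exacts [integrable_comp_pathShift μ hGi k, integrable_zero _ _ _]
      rw [Finset.sum_congr rfl hsum, Finset.sum_add_distrib, ← Finset.sum_filter,
        Finset.sum_const, Finset.sum_const] at hle
      have hcard : (((Finset.range n).filter fun k => n ≤ k + N).card : ℝ) ≤ N := by
        have : ((Finset.range n).filter fun k => n ≤ k + N) ⊆ Finset.Ico (n - N) n := by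
          intro k hk
          simp only [Finset.mem_filter, Finset.mem_range] at hk
          rw [Finset.mem_Ico]
          omega
        have := Finset.card_le_card this
        rw [Nat.card_Ico] at this
        exact_mod_cast (by omega : _ ≤ N)
      have hmul := mul_le_mul_of_nonneg_right hcard (integral_nonneg (μ := 𝔓) hG0)
      have hln := hl n hn
      simp only [integral_const, probReal_univ, one_smul, Finset.card_range, nsmul_eq_mul] at hle
      linarith
    by_contra! hcon
    obtain ⟨n, hn1⟩ := exists_nat_gt
      ((N * ∫ ω, G ω ∂𝔓) / (l - c - ∫ ω, (B N).indicator G ω ∂𝔓))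
    rw [div_lt_iff₀ (by linarith)] at hn1
    have h0 : 0 ≤ N * ∫ ω, G ω ∂𝔓 := mul_nonneg N.cast_nonneg (integral_nonneg hG0)
    have hn0 : 1 ≤ n := by
      by_contra h
      have : n = 0 := by omega
      subst this
      simp only [Nat.cast_zero, zero_mul] at hn1
      linarith
    have := hn n hn0
    nlinarith
  -- Almost every path leaves `B N` for large `N`, by `hc`, so dominated convergence removes the
  -- remaining cost.
  have hlim : Tendsto (fun N => ∫ ω, (B N).indicator G ω ∂𝔓) atTop (𝓝 (∫ _ω : ℕ → S, (0 : ℝ) ∂𝔓)) := by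
    refine tendsto_integral_of_dominated_convergence G
      (fun N => (hBind N).aestronglyMeasurable) hGi (fun N => .of_forall fun ω => ?_) ?_
    · rw [Real.norm_of_nonneg (Set.indicator_nonneg (fun _ _ => hG0 _) _)]
      exact Set.indicator_le_self' (fun _ _ => hG0 _) ω
    · filter_upwards [hc] with ω ⟨n, hn, hω⟩
      refine tendsto_const_nhds.congr' ?_
      filter_upwards [eventually_ge_atTop n] with N hN
      have hmem : ω ∉ B N := fun h => not_lt_of_ge hω (h n hn hN)
      rw [Set.indicator_of_notMem hmem]
  rw [integral_zero] at hlim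
  have := ge_of_tendsto' hlim hbound
  linarith

/-- Almost surely, the cocycle eventually grows at least at the rate `c`, if `c` is smaller than
all the logarithmic means. -/
theorem ae_eventually_exp_le (hp : IsSubmulCocycle p)
    (hint : Integrable (fun ω => Real.posLog (p 1 ω)) 𝔓)
    (hpos : ∀ n, 1 ≤ n → ∀ᵐ ω ∂𝔓, 0 < p n ω)
    (hlog : ∀ n, 1 ≤ n → Integrable (fun ω => Real.log (p n ω)) 𝔓) {l c : ℝ}
    (hl : ∀ n : ℕ, 1 ≤ n → l * n ≤ ∫ ω, Real.log (p n ω) ∂𝔓) (hc : c < l) :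
    ∀ᵐ ω ∂𝔓, ∀ᶠ n : ℕ in atTop, Real.exp (c * n) ≤ p n ω := by
  -- The free constant `C` gives `E` the inclusion needed for the zero-one law: prepending a letter
  -- multiplies the bound by `p 1 ω` and `exp (-c)`, which a larger constant absorbs.
  set E : Set (ℕ → S) := {ω | ∃ C : ℕ, ∃ᶠ n : ℕ in atTop, p n ω < C * Real.exp (c * n)}
  have hE : MeasurableSet E := by
    simp only [E, frequently_atTop, Set.ofPred_exists, Set.ofPred_forall]
    refine .iUnion fun C => .iInter fun a => .iUnion fun n => ?_
    simp only [Set.ofPred_and]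
    exact (MeasurableSet.const _).inter (measurableSet_lt (hp.measurable n) measurable_const)
  have hsub : pathShift 1 ⁻¹' E ⊆ E := by
    rintro ω ⟨C, hω⟩
    obtain ⟨C', hC'⟩ := exists_nat_gt (p 1 ω * C * Real.exp (-c))
    refine ⟨C', ?_⟩
    rw [frequently_atTop] at hω ⊢
    intro a
    obtain ⟨n, hn, hlt⟩ := hω a
    refine ⟨1 + n, by omega, (hp.add_le 1 n ω).trans_lt ?_⟩
    have h1 := mul_le_mul_of_nonneg_left hlt.le (hp.nonneg 1 ω)
    refine h1.trans_lt ?_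
    have h2 := mul_lt_mul_of_pos_right hC' (Real.exp_pos (c * ((1 + n : ℕ) : ℝ)))
    refine lt_of_eq_of_lt ?_ h2
    have : Real.exp (c * n) = Real.exp (-c) * Real.exp (c * ((1 + n : ℕ) : ℝ)) := by
      rw [← Real.exp_add]
      push_cast
      ring_nf
    rw [this]
    ring
  rcases measure_zero_or_one_of_shift_preimage_subset μ hE hsub with h | h
  · filter_upwards [measure_eq_zero_iff_ae_notMem.1 h] with ω hω
    by_contra hcon
    rw [not_eventually] at hcon
    exact hω ⟨1, by simpa only [Nat.cast_one, one_mul, not_le] using hcon⟩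
  · exfalso
    -- A rate strictly between `c` and `l` swallows `C` at large times, so almost every path has a
    -- time `n ≥ 1` of growth at most `exp (c' * n)`, which forces `l ≤ c'`.
    obtain ⟨c', hc1, hc2⟩ := exists_between hc
    refine not_le_of_gt hc2 (hp.le_of_forall_mul_le_integral_log μ hint hpos hlog hl ?_)
    have hae : ∀ᵐ ω ∂𝔓, ω ∈ E := (prob_compl_eq_zero_iff hE).2 h
    filter_upwards [hae] with ω ⟨C, hω⟩
    have hev : ∀ᶠ n : ℕ in atTop, (C : ℝ) ≤ Real.exp ((c' - c) * n) :=
      (Real.tendsto_exp_atTop.comp (tendsto_natCast_atTop_atTop.const_mul_atTop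
        (sub_pos.2 hc1))).eventually_ge_atTop _
    obtain ⟨n, hlt, hle, hn⟩ := (hω.and_eventually (hev.and (eventually_ge_atTop 1))).exists
    refine ⟨n, hn, hlt.le.trans ?_⟩
    calc C * Real.exp (c * n) ≤ Real.exp ((c' - c) * n) * Real.exp (c * n) :=
          mul_le_mul_of_nonneg_right hle (Real.exp_pos _).le
      _ = Real.exp (c' * n) := by rw [← Real.exp_add]; ring_nf

end IsSubmulCocycle

/-! ### Limits in the extended reals and Fekete's lemma. -/

/-- Rational thresholds suffice by density; being countably many, they allow the almost sure bounds
to be combined outside one null set. -/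
theorem tendsto_ereal_of_forall_real {x : ℕ → EReal} {l : EReal}
    (hle : ∀ c : ℚ, l < ((c : ℝ) : EReal) → ∀ᶠ n in atTop, x n ≤ ((c : ℝ) : EReal))
    (hge : ∀ c : ℚ, ((c : ℝ) : EReal) < l → ∀ᶠ n in atTop, ((c : ℝ) : EReal) ≤ x n) :
    Tendsto x atTop (𝓝 l) := by
  refine tendsto_order.2 ⟨fun a ha => ?_, fun a ha => ?_⟩
  · obtain ⟨c, hc1, hc2⟩ := EReal.lt_iff_exists_rat_btwn.1 ha
    exact (hge c hc2).mono fun n hn => hc1.trans_le hn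
  · obtain ⟨c, hc1, hc2⟩ := EReal.lt_iff_exists_rat_btwn.1 ha
    exact (hle c hc1).mono fun n hn => hn.trans_lt hc2

theorem one_div_mul_coe (n : ℕ) (x : ℝ) :
    ((1 / (n : ℝ) : ℝ) : EReal) * (x : EReal) = ((x / n : ℝ) : EReal) := by
  rw [← EReal.coe_mul]
  congr 1
  ring

theorem one_div_mul_bot {n : ℕ} (hn : 1 ≤ n) : ((1 / (n : ℝ) : ℝ) : EReal) * ⊥ = ⊥ :=
  EReal.coe_mul_bot_of_pos (by positivity)

/-- Fekete's lemma for subadditive sequences that may take the value `-∞`. -/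
theorem tendsto_iInf_of_subadditive {q : ℕ → EReal} {u : ℕ → ℝ}
    (hbot : ∀ m n, q m = ⊥ → q (m + n) = ⊥)
    (hu : ∀ n, 1 ≤ n → q n ≠ ⊥ → q n = u n)
    (hsub : (∀ n, 1 ≤ n → q n ≠ ⊥) → Subadditive u) :
    Tendsto (fun n : ℕ => ((1 / (n : ℝ) : ℝ) : EReal) * q n) atTop
      (𝓝 (⨅ (n : ℕ) (_ : 1 ≤ n), ((1 / (n : ℝ) : ℝ) : EReal) * q n)) := by
  refine tendsto_order.2 ⟨fun a ha => ?_, fun a ha => ?_⟩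
  · filter_upwards [eventually_ge_atTop 1] with n hn
    exact ha.trans_le (iInf₂_le n hn)
  simp only [iInf_lt_iff] at ha
  obtain ⟨m, hm, ha⟩ := ha
  by_cases h : ∀ n, 1 ≤ n → q n ≠ ⊥
  · obtain ⟨c, hc1, hc2⟩ := EReal.lt_iff_exists_real_btwn.1 ha
    rw [hu m hm (h m hm), one_div_mul_coe, EReal.coe_lt_coe_iff] at hc1
    filter_upwards [(hsub h).eventually_div_lt_of_div_lt (by omega) hc1,
      eventually_ge_atTop 1] with n hn hn1
    rw [hu n hn1 (h n hn1), one_div_mul_coe]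
    exact (EReal.coe_lt_coe_iff.2 hn).trans hc2
  -- A single value `⊥` propagates to all later indices, so the sequence is eventually `⊥`.
  · push Not at h
    obtain ⟨k, -, hk⟩ := h
    filter_upwards [eventually_ge_atTop k, eventually_ge_atTop 1] with n hkn hn1
    obtain ⟨j, rfl⟩ := Nat.exists_eq_add_of_le hkn
    rw [hbot k j hk, one_div_mul_bot hn1]
    exact bot_le.trans_lt ha

theorem one_div_mul_log_le {x c : ℝ} {n : ℕ} (hn : 1 ≤ n) (hx : 0 ≤ x)
    (h : x ≤ Real.exp (c * n)) :
    ((1 / (n : ℝ) : ℝ) : EReal) * ENNReal.log (ENNReal.ofReal x) ≤ c := by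
  rcases hx.eq_or_lt with rfl | hx
  · simp only [ENNReal.ofReal_zero, ENNReal.log_zero, one_div_mul_bot hn, bot_le]
  · rw [ENNReal.log_ofReal_of_pos hx, one_div_mul_coe, EReal.coe_le_coe_iff,
      div_le_iff₀ (by positivity)]
    exact (Real.log_le_iff_le_exp hx).2 h

theorem le_one_div_mul_log {x c : ℝ} {n : ℕ} (hn : 1 ≤ n) (h : Real.exp (c * n) ≤ x) :
    (c : EReal) ≤ ((1 / (n : ℝ) : ℝ) : EReal) * ENNReal.log (ENNReal.ofReal x) := by
  have hx := (Real.exp_pos _).trans_le h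
  rw [ENNReal.log_ofReal_of_pos hx, one_div_mul_coe, EReal.coe_le_coe_iff,
    le_div_iff₀ (by positivity)]
  exact (Real.le_log_iff_exp_le hx).2 h

/-! ### The Furstenberg–Kesten theorem. -/

namespace IsSubmulCocycle

variable {S : Type w} [MeasurableSpace S] {p : ℕ → (ℕ → S) → ℝ}
  (μ : Measure S) [IsProbabilityMeasure μ]

local notation "𝔓" => Measure.infinitePi (fun _ : ℕ => μ)

local notation "𝓔" n => extExpectation 𝔓 (fun ω => ENNReal.log (ENNReal.ofReal (p n ω)))

/-- Since `p 0 ω ≤ (p 0 ω)^2` and `p 0 ω ≤ 1`, the value is 0 or 1, and `Real.log` vanishes at both.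
-/
theorem log_zero_time (hp : IsSubmulCocycle p) (ω : ℕ → S) : Real.log (p 0 ω) = 0 := by
  have h1 := hp.add_le 0 0 ω
  rw [pathShift_zero, add_zero] at h1
  rcases (hp.nonneg 0 ω).eq_or_lt with h | h
  · rw [← h, Real.log_zero]
  · have h2 : 1 ≤ p 0 ω := by
      by_contra! h2
      nlinarith
    rw [le_antisymm (hp.zero_le_one ω) h2, Real.log_one]

/-- Contrapositive of `log p_m ≥ log p_{m+n} - log⁺ (p_n ∘ θ^m)`: if `log p_{m+n}` is integrable,
the right side is an integrable lower bound. -/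
theorem extExpectation_log_add_eq_bot (hp : IsSubmulCocycle p)
    (hint : Integrable (fun ω => Real.posLog (p 1 ω)) 𝔓) (m n : ℕ) (h : (𝓔 m) = ⊥) :
    (𝓔 (m + n)) = ⊥ := by
  by_contra hne
  obtain ⟨hpos, hlog, -⟩ := extExpectation_log_of_ne_bot (hp.nonneg _) (hp.measurable _)
    (hp.integrable_posLog μ hint _) hne
  refine extExpectation_log_ne_bot_of_exp_le (hp.nonneg m) (hp.integrable_posLog μ hint m)
    ((integrable_comp_pathShift μ (hp.integrable_posLog μ hint n) m).sub hlog) ?_ h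
  filter_upwards [hpos] with ω hω
  have h1 := (hp.add_le m n ω).trans
    (mul_le_mul_of_nonneg_left (le_exp_posLog (hp.nonneg n (pathShift m ω))) (hp.nonneg m ω))
  rw [Pi.sub_apply, neg_sub, Real.exp_sub, Real.exp_log hω, div_le_iff₀ (Real.exp_pos _)]
  exact h1

theorem subadditive_integral_log (hp : IsSubmulCocycle p)
    (hpos : ∀ n, 1 ≤ n → ∀ᵐ ω ∂𝔓, 0 < p n ω)
    (hlog : ∀ n, 1 ≤ n → Integrable (fun ω => Real.log (p n ω)) 𝔓) :
    Subadditive fun n => ∫ ω, Real.log (p n ω) ∂𝔓 := by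
  intro m n
  rcases Nat.eq_zero_or_pos m with rfl | hm
  · simp [hp.log_zero_time]
  rcases Nat.eq_zero_or_pos n with rfl | hn
  · simp [hp.log_zero_time]
  have hi := integrable_comp_pathShift μ (hlog n hn) m
  beta_reduce
  rw [← integral_comp_pathShift μ (hp.measurable n).log m, ← integral_add (hlog m hm) hi]
  refine integral_mono_ae (hlog _ (by omega)) ((hlog m hm).add hi) ?_
  filter_upwards [hpos m hm, (measurePreserving_pathShift μ m).quasiMeasurePreserving.ae
    (hpos n hn), hpos (m + n) (by omega)] with ω h1 h2 h3
  rw [← Real.log_mul h1.ne' h2.ne']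
  exact Real.log_le_log h3 (hp.add_le m n ω)

/-- The **Furstenberg–Kesten theorem** for submultiplicative cocycles over a Bernoulli shift. -/
theorem furstenberg_kesten (hp : IsSubmulCocycle p)
    (hint : Integrable (fun ω => Real.posLog (p 1 ω)) 𝔓) :
    ∃ l : EReal, l < ⊤ ∧
      (∀ᵐ ω ∂𝔓, Tendsto (fun n : ℕ => ((1 / (n : ℝ) : ℝ) : EReal) *
        ENNReal.log (ENNReal.ofReal (p n ω))) atTop (𝓝 l)) ∧
      l = (⨅ (n : ℕ) (_ : 1 ≤ n), ((1 / (n : ℝ) : ℝ) : EReal) * 𝓔 n) ∧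
      Tendsto (fun n : ℕ => ((1 / (n : ℝ) : ℝ) : EReal) * 𝓔 n) atTop (𝓝 l) := by
  have hpl := hp.integrable_posLog μ hint
  have htop : ∀ n, (𝓔 n) < ⊤ := fun n => extExpectation_log_lt_top (hp.nonneg n) (hpl n)
  have hreal : ∀ n, (𝓔 n) ≠ ⊥ → _ := fun n h =>
    extExpectation_log_of_ne_bot (hp.nonneg n) (hp.measurable n) (hpl n) h
  refine ⟨_, ?_, ?_, rfl, tendsto_iInf_of_subadditive
    (hp.extExpectation_log_add_eq_bot μ hint) (fun n _ h => (hreal n h).2.2)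
    fun h => hp.subadditive_integral_log μ (fun n hn => (hreal n (h n hn)).1)
      fun n hn => (hreal n (h n hn)).2.1⟩
  · refine (iInf₂_le 1 le_rfl).trans_lt ?_
    simpa using htop 1
  set l : EReal := ⨅ (n : ℕ) (_ : 1 ≤ n), ((1 / (n : ℝ) : ℝ) : EReal) * 𝓔 n with hl
  have hle : ∀ c : ℚ, l < ((c : ℝ) : EReal) →
      ∀ᵐ ω ∂𝔓, ∀ᶠ n : ℕ in atTop, p n ω ≤ Real.exp (c * n) := by
    intro c hc
    rw [hl] at hc
    simp only [iInf_lt_iff] at hc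
    obtain ⟨m, hm, hc⟩ := hc
    have hm0 : (0 : ℝ) < m := by exact_mod_cast hm
    have hlt : (𝓔 m) < ((c * m : ℝ) : EReal) := by
      by_cases h : (𝓔 m) = ⊥
      · rw [h]; exact EReal.bot_lt_coe _
      · rw [(hreal m h).2.2, one_div_mul_coe, EReal.coe_lt_coe_iff, div_lt_iff₀ hm0] at hc
        rw [(hreal m h).2.2]
        exact EReal.coe_lt_coe_iff.2 hc
    obtain ⟨R, hR, hlt⟩ :=
      exists_integral_log_max_exp_lt (hp.nonneg m) (hp.measurable m) (hpl m) hlt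
    exact hp.ae_eventually_le_exp μ hint hm hR hlt
  have hge : ∀ c : ℚ, ((c : ℝ) : EReal) < l →
      ∀ᵐ ω ∂𝔓, ∀ᶠ n : ℕ in atTop, Real.exp (c * n) ≤ p n ω := by
    intro c hc
    -- `l` may be `⊤` as far as the type tells, so a real `b` between `c` and `l` takes its place as
    -- lower bound of the means.
    obtain ⟨b, hb1, hb2⟩ := EReal.lt_iff_exists_real_btwn.1 hc
    rw [EReal.coe_lt_coe_iff] at hb1
    have hn : ∀ n : ℕ, 1 ≤ n → (b : EReal) < ((1 / (n : ℝ) : ℝ) : EReal) * 𝓔 n :=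
      fun n hn => hb2.trans_le (iInf₂_le n hn)
    have hne : ∀ n, 1 ≤ n → (𝓔 n) ≠ ⊥ := fun n h1 h => by
      have := hn n h1
      rw [h, one_div_mul_bot h1] at this
      exact not_lt_bot this
    refine hp.ae_eventually_exp_le μ hint (fun n h1 => (hreal n (hne n h1)).1)
      (fun n h1 => (hreal n (hne n h1)).2.1) (l := b) (fun n h1 => ?_) hb1
    have := hn n h1
    rw [(hreal n (hne n h1)).2.2, one_div_mul_coe, EReal.coe_lt_coe_iff,
      lt_div_iff₀ (by exact_mod_cast h1)] at this
    exact this.le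
  filter_upwards [ae_all_iff.2 fun c => eventually_imp_distrib_left.2 (hle c),
    ae_all_iff.2 fun c => eventually_imp_distrib_left.2 (hge c)] with ω h1 h2
  refine tendsto_ereal_of_forall_real (fun c hc => ?_) fun c hc => ?_
  · filter_upwards [h1 c hc, eventually_ge_atTop 1] with n hn hn1
    exact one_div_mul_log_le hn1 (hp.nonneg n ω) hn
  · filter_upwards [h2 c hc, eventually_ge_atTop 1] with n hn hn1
    exact le_one_div_mul_log hn1 hn

end IsSubmulCocycle

/-! ### Application to the operators on the model space. -/

theorem randomWord_add {S : Type w} (m n : ℕ) (ω : ℕ → S) :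
    randomWord (m + n) ω = randomWord m ω ++ randomWord n (pathShift m ω) := by
  simp only [randomWord, List.ofFn_add, pathShift]
  congr 2
  funext i
  simp [add_comm]

namespace KernelSystem

variable {X : Type u} {H : Type v} [NormedAddCommGroup H] [InnerProductSpace ℂ H]
  [CompleteSpace H] {S : Type w} {I : S → Type t}

theorem wordOp_append (D : KernelSystem X H S I) (w₁ w₂ : List S) :
    D.wordOp (w₁ ++ w₂) = (D.wordOp w₂).comp (D.wordOp w₁) := by
  induction w₁ with
  | nil => rfl
  | cons s w ih =>
    rw [List.cons_append, wordOp, wordOp, ih]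
    rfl

theorem isSubmulCocycle_norm_wordOp [MeasurableSpace S] (D : KernelSystem X H S I)
    (hmeas : ∀ n : ℕ, Measurable fun ω : ℕ → S => ‖D.wordOp (randomWord n ω)‖) :
    IsSubmulCocycle fun (n : ℕ) (ω : ℕ → S) => ‖D.wordOp (randomWord n ω)‖ where
  nonneg _ _ := norm_nonneg _
  -- Only an inequality: the identity of a trivial model space has norm 0.
  zero_le_one _ := ContinuousLinearMap.norm_id_le
  add_le m n ω := by
    rw [randomWord_add, wordOp_append, mul_comm]
    exact ContinuousLinearMap.opNorm_comp_le _ _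
  measurable := hmeas
  dependsOnFirst n ω ω' h := by
    have : randomWord n ω = randomWord n ω' := by
      rw [randomWord, randomWord]
      congr 1
      funext i
      exact h i i.2
    simp only [this]

end KernelSystem

theorem theorem5p1 {X : Type u} {H : Type v} [NormedAddCommGroup H] [InnerProductSpace ℂ H]
    [CompleteSpace H] {S : Type w} {I : S → Type t} [MeasurableSpace S]
    (D : KernelSystem X H S I)
    (hC : ∀ s : S, ∃ C : D.Model →L[ℂ] D.Model, D.IsCreationOp s C)
    (μ : Measure S) [IsProbabilityMeasure μ]
    (P : Measure (ℕ → S)) (hP : P = Measure.infinitePi fun _ : ℕ => μ)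
    (hmeas : ∀ n : ℕ, Measurable fun ω : ℕ → S => ‖D.wordOp (randomWord n ω)‖)
    (hint : Integrable (fun ω : ℕ → S => Real.posLog ‖D.creationOp (ω 0)‖) P) :
    (∀ n : ℕ, ∫⁻ ω, (D.logNorm (randomWord n ω)).toENNReal ∂P < ⊤) ∧
    ∃ lam : EReal, lam < ⊤ ∧
      (∀ᵐ ω ∂P, Tendsto (fun n : ℕ => ((1 / (n : ℝ) : ℝ) : EReal) * D.logNorm (randomWord n ω))
        atTop (𝓝 lam)) ∧
      lam = ⨅ (n : ℕ) (_ : 1 ≤ n),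
        ((1 / (n : ℝ) : ℝ) : EReal) * extExpectation P (fun ω => D.logNorm (randomWord n ω)) ∧
      Tendsto (fun n : ℕ =>
        ((1 / (n : ℝ) : ℝ) : EReal) * extExpectation P (fun ω => D.logNorm (randomWord n ω)))
        atTop (𝓝 lam) := by
  subst hP
  have hp := D.isSubmulCocycle_norm_wordOp hmeas
  -- For a one-letter word, `wordOp` unfolds to the identity composed with `D.creationOp (ω 0)`, so
  -- `hint` applies definitionally.
  have hint' : Integrable (fun ω : ℕ → S => Real.posLog ‖D.wordOp (randomWord 1 ω)‖)
      (Measure.infinitePi fun _ : ℕ => μ) := hint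
  exact ⟨fun n => (lintegral_log_toENNReal (hp.nonneg n)
    (hp.integrable_posLog μ hint' n)).trans_lt ENNReal.ofReal_lt_top,
    hp.furstenberg_kesten μ hint'⟩
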